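/- Let $\mathcal H^R,\mathcal H^A,\mathcal H^B$ be finite-dimensional Hilbert spaces and let $|\psi\rangle^{RAB}\in\mathcal H^R\otimes\mathcal H^A\otimes\mathcal H^B$ be a unit vector whose reduced state on $R$ is $\psi^R=\mathbb 1^R/D$ (so that $D=\dim\mathcal H^R$). Write $\psi^{RAB}=|\psi\rangle\langle\psi|^{RAB}$, let $\psi^B$ be the reduced state on $B$, and let $\lambda_0^B$ be the largest eigenvalue of $\psi^B$. For an integer $K\ge 1$ let $\Phi_K^+$ be the projector onto $|\Phi_K^+\rangle=\frac1{\sqrt K}\sum_{l=0}^{K-1}|l\rangle\otimes|l\rangle\in\mathcal H^{\overline A}\otimes\mathcal H^{\overline B}$, and let $\mathcal H^{B'}$ be a copy of $\mathcal H^A$ held by $B$. An algorithm for exact state merging of $|\psi\rangle^{RAB}$ with initial and final resources of Schmidt ranks $K,L\ge 1$ (where $\mathcal H^{\overline A}$ and $\mathcal H^{\overline B}$ have finite dimensions at least $\max\{K,L\}$) is an LOCC map $\mathcal M$ (local operations and two-way classical communication) between the party $A$, holding $\mathcal H^A\otimes\mathcal H^{\overline A}$ before and $\mathcal H^{\overline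 A}$ after, and the party $B$, holding $\mathcal H^B\otimes\mathcal H^{\overline B}$ before and $\mathcal H^{B'}\otimes\mathcal H^B\otimes\mathcal H^{\overline B}$ after, such that \[ (\mathrm{id}^R\otimes\mathcal M)\bigl(\psi^{RAB}\otimes{\Phi_K^+}^{\overline A\,\overline B}\bigr)=\psi^{RB'B}\otimes{\Phi_L^+}^{\overline A\,\overline B}, \] where $\psi^{RB'B}$ is $\psi^{RAB}$ with $\mathcal H^A$ replaced by its copy $\mathcal H^{B'}$. It is non-catalytic if $L=1$. Then every algorithm for exact state merging of $|\psi\rangle^{RAB}$ satisfies \[ \log_2 K-\log_2 L\ \ge\ \log_2\bigl(\lambda_0^B D\bigr), \] and every algorithm for non-catalytic exact state merging of $|\psi\rangle^{RAB}$ satisfies \[ \log_2 K\ \ge\ \log_2\bigl\lceil\lambda_0^B D\bigr\rceil . \] -/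

import Mathlib

open scoped Kronecker Topology ComplexOrder

/-! Finite-dimensional quantum systems are `ℂ^m` for a finite index type `m`, with the standard
orthonormal basis; a tensor product of systems has the product index type.  Operators on the
system `m` are the matrices `Matrix m m ℂ`. -/

/-- Linear maps from the operators on the system `m` to the operators on the system `n`. -/
abbrev Superop (m n : Type) : Type := Matrix m m ℂ →ₗ[ℂ] Matrix n n ℂ

/-- The map `id^r ⊗ E`: apply `E` to each of the `m`-blocks of an operator on `r ⊗ m`. -/
def ampliation {m n : Type} (r : Type) (E : Superop m n) (X : Matrix (r × m) (r × m) ℂ) :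
    Matrix (r × n) (r × n) ℂ :=
  Matrix.of fun p q => E (Matrix.of fun x y => X (p.1, x) (q.1, y)) p.2 q.2

/-- Complete positivity: `id^r ⊗ E` is positive for every finite-dimensional ancilla `r`. -/
def IsCP {m n : Type} [Fintype m] [Fintype n] (E : Superop m n) : Prop :=
  ∀ (r : Type) [Fintype r] (X : Matrix (r × m) (r × m) ℂ),
    X.PosSemidef → (ampliation r E X).PosSemidef

/-- Quantum channels: completely positive trace-preserving maps. -/
def IsChannel {m n : Type} [Fintype m] [Fintype n] (E : Superop m n) : Prop :=
  IsCP E ∧ ∀ X, (E X).trace = X.trace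

/-- Quantum instruments with outcomes in `ι`: completely positive maps whose sum over all
outcomes preserves the trace. -/
def IsInstrument {ι m n : Type} [Fintype m] [Fintype n] (E : ι → Superop m n) : Prop :=
  (∀ j, IsCP (E j)) ∧ ∀ X, HasSum (fun j => (E j X).trace) X.trace

/-- `E = F ⊗ T`; the Kronecker products span, so that `F` and `T` determine `E`. -/
def IsTensorMap {a b a' b' : Type} (E : Superop (a × b) (a' × b'))
    (F : Superop a a') (T : Superop b b') : Prop :=
  ∀ (X : Matrix a a ℂ) (Y : Matrix b b ℂ), E (X ⊗ₖ Y) = F X ⊗ₖ T Y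

/-- One-way local instruments: one of the two parties applies an instrument to its own system and
announces the outcome `j`, then the other party applies a channel that may depend on `j`. -/
def IsOneWayLocal {ι a b a' b' : Type} [Fintype a] [Fintype b] [Fintype a'] [Fintype b']
    (E : ι → Superop (a × b) (a' × b')) : Prop :=
  (∃ (F : ι → Superop a a') (T : ι → Superop b b'),
    IsInstrument F ∧ (∀ j, IsChannel (T j)) ∧ ∀ j, IsTensorMap (E j) (F j) (T j)) ∨
  (∃ (T : ι → Superop a a') (F : ι → Superop b b'),
    (∀ j, IsChannel (T j)) ∧ IsInstrument F ∧ ∀ j, IsTensorMap (E j) (T j) (F j))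

/-- `E'` is a coarse-graining of `E`: each outcome `k` of `E'` gathers a set of outcomes of `E`. -/
def IsCoarseGraining {κ ι m n : Type} (E' : κ → Superop m n) (E : ι → Superop m n) : Prop :=
  ∃ f : ι → κ, ∀ k X, HasSum (fun j : {j : ι // f j = k} => E j X) (E' k X)

/-- `E'` is LOCC-linked to `E`: for each outcome `j` of `E` the parties go on with a one-way local
instrument chosen depending on `j` (so may the party that measures in it), and `E'` is a
coarse-graining of the composition. -/
def IsLOCCLinked {κ ι a b p q p' q' : Type} [Fintype p] [Fintype q] [Fintype p'] [Fintype q']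
    (E' : κ → Superop (a × b) (p' × q')) (E : ι → Superop (a × b) (p × q)) : Prop :=
  ∃ (l : ι → Type) (_ : ∀ j, Countable (l j)) (G : ∀ j, l j → Superop (p × q) (p' × q')),
    (∀ j, IsOneWayLocal (G j)) ∧
    IsCoarseGraining E' (fun s : (Σ j, l j) => (G s.1 s.2).comp (E s.1))

/-- LOCC maps (two-way, with finitely or infinitely many rounds): there are instruments
`E 0, E 1, …`, the first of them one-way local and each LOCC-linked to the one before it, such
that stopping after the round `n` (each party turns what it holds into its part of the output by a
channel that may depend on the outcome, and the outcome is forgotten) implements a map `N n`, and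
`N n` converges to `M`.  The systems `p n`, `q n` held after each round are arbitrary.  A protocol
with finitely many rounds is the case in which the later rounds are trivial. -/
def IsLOCC {a b a' b' : Type} [Fintype a] [Fintype b] [Fintype a'] [Fintype b']
    (M : Superop (a × b) (a' × b')) : Prop :=
  IsChannel M ∧
  ∃ (p q : ℕ → Type) (_ : ∀ n, Fintype (p n)) (_ : ∀ n, Fintype (q n))
    (ι : ℕ → Type) (_ : ∀ n, Countable (ι n))
    (E : ∀ n, ι n → Superop (a × b) (p n × q n)),
    IsOneWayLocal (E 0) ∧
    (∀ n, IsLOCCLinked (E (n + 1)) (E n)) ∧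
    ∃ (S : ∀ n, ι n → Superop (p n) a') (T : ∀ n, ι n → Superop (q n) b')
      (W : ∀ n, ι n → Superop (p n × q n) (a' × b')) (N : ℕ → Superop (a × b) (a' × b')),
      (∀ n j, IsChannel (S n j) ∧ IsChannel (T n j) ∧ IsTensorMap (W n j) (S n j) (T n j)) ∧
      (∀ n X, HasSum (fun j => W n j (E n j X)) (N n X)) ∧
      ∀ X, Filter.Tendsto (fun n => N n X) Filter.atTop (𝓝 (M X))

/-- The operator `|v⟩⟨v|`. -/
def pureState {m : Type} (v : m → ℂ) : Matrix m m ℂ := Matrix.vecMulVec v (star v)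

/-- Partial trace over the second tensor factor. -/
def traceRight {m n : Type} [Fintype n] (X : Matrix (m × n) (m × n) ℂ) : Matrix m m ℂ :=
  Matrix.of fun i j => ∑ k, X (i, k) (j, k)

/-- Partial trace over the first tensor factor. -/
def traceLeft {m n : Type} [Fintype m] (X : Matrix (m × n) (m × n) ℂ) : Matrix n n ℂ :=
  Matrix.of fun i j => ∑ k, X (k, i) (k, j)

/-- The reduced state `ψ^R` of a vector `ψ` of `R ⊗ A ⊗ B`. -/
def reducedR {R A B : Type} [Fintype A] [Fintype B] (ψ : EuclideanSpace ℂ (R × A × B)) :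
    Matrix R R ℂ :=
  traceRight (pureState ⇑ψ)

/-- The reduced state `ψ^B` of a vector `ψ` of `R ⊗ A ⊗ B`. -/
def reducedB {R A B : Type} [Fintype R] [Fintype A] (ψ : EuclideanSpace ℂ (R × A × B)) :
    Matrix B B ℂ :=
  traceLeft (traceLeft (pureState ⇑ψ))

/-- The vector `|Φ⁺_K⟩ = K^{-1/2} ∑_{l < K} |l⟩ ⊗ |l⟩` of `ℂ^dA ⊗ ℂ^dB`, for `K ≤ dA` and
`K ≤ dB`. -/
noncomputable def maxEntangled (K dA dB : ℕ) : Fin dA × Fin dB → ℂ :=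
  fun x => if x.1.val = x.2.val ∧ x.1.val < K then ((Real.sqrt K)⁻¹ : ℝ) else 0

/-- The vector `|ψ⟩^{RAB} ⊗ |Φ⟩^{ĀB̄}`; party `A` holds `A ⊗ Ā` and party `B` holds `B ⊗ B̄`. -/
def mergeInput {R A B : Type} {dA dB : ℕ} (ψ : EuclideanSpace ℂ (R × A × B))
    (Φ : Fin dA × Fin dB → ℂ) : R × ((A × Fin dA) × (B × Fin dB)) → ℂ :=
  fun x => ψ (x.1, x.2.1.1, x.2.2.1) * Φ (x.2.1.2, x.2.2.2)

/-- The vector `|ψ⟩^{RB'B} ⊗ |Φ⟩^{ĀB̄}`; party `A` holds `Ā` and party `B` holds `B' ⊗ B ⊗ B̄`,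
where `B'` is a copy of `A`. -/
def mergeOutput {R A B : Type} {dA dB : ℕ} (ψ : EuclideanSpace ℂ (R × A × B))
    (Φ : Fin dA × Fin dB → ℂ) : R × (Fin dA × ((A × B) × Fin dB)) → ℂ :=
  fun x => ψ (x.1, x.2.2.1.1, x.2.2.1.2) * Φ (x.2.1, x.2.2.2)

/-- `M` is an algorithm for exact state merging of `ψ`, with an initial resource state of Schmidt
rank `K` and a final resource state of Schmidt rank `L` on `Ā = ℂ^dA` and `B̄ = ℂ^dB`: `M` is an
LOCC map between `A` and `B` with `(id^R ⊗ M)(ψ^{RAB} ⊗ Φ⁺_K) = ψ^{RB'B} ⊗ Φ⁺_L`.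
The non-catalytic task is the case `L = 1`. -/
structure IsExactMerging {R A B : Type} [Fintype R] [Fintype A] [Fintype B]
    (ψ : EuclideanSpace ℂ (R × A × B)) (K L : ℕ) {dA dB : ℕ}
    (M : Superop ((A × Fin dA) × (B × Fin dB)) (Fin dA × ((A × B) × Fin dB))) : Prop where
  one_le_K : 1 ≤ K
  one_le_L : 1 ≤ L
  K_le : K ≤ dA ∧ K ≤ dB
  L_le : L ≤ dA ∧ L ≤ dB
  isLOCC : IsLOCC M
  merges : ampliation R M (pureState (mergeInput ψ (maxEntangled K dA dB))) =
    pureState (mergeOutput ψ (maxEntangled L dA dB))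

/-! The obstruction is separability across the cut between `R` with `A` and `B`: an LOCC map, even
one with infinitely many rounds, cannot leave the closed cone of separable operators, although the
reference `R` sits on the side of `A` (`IsLOCC.preservesSep`). The merged state f = ψ ⊗ Φ_L is
highly entangled across this cut: `A` retains only its half of Φ_L and ψ^R = 1/D, so all nonzero
squared Schmidt coefficients equal 1/(DL). Hence ⟨f|Z|f⟩ ≤ tr Z/(DL) for every separable Z
(`dotProduct_mulVec_le_of_mem_sepCone`).

Conversely, a λ-eigenvector v of ψ^B gives a product vector s whose squared overlap with the input φ
= ψ ⊗ Φ_K is λ‖s‖²/K. Since the channel takes φ to f, the overlap of its output on s with f is at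
least this large (`overlap_le_of_map_pureState`). Together, λ/K ≤ 1/(DL). -/

/-! ### LOCC maps preserve separability -/

section Separability

variable {r a b p q : Type}

/-- `ampliation` as a linear map. -/
def ampliationLinear {m n : Type} (r : Type) (E : Superop m n) : Superop (r × m) (r × n) where
  toFun := ampliation r E
  map_add' X Y := by
    ext i j
    exact congrFun (congrFun (E.map_add (Matrix.of fun x y => X (i.1, x) (j.1, y))
      (Matrix.of fun x y => Y (i.1, x) (j.1, y))) i.2) j.2
  map_smul' c X := by
    ext i j
    exact congrFun (congrFun (E.map_smul c (Matrix.of fun x y => X (i.1, x) (j.1, y))) i.2) j.2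

/-- The operator `X ⊗ Y` on `(r ⊗ a) ⊗ b`, regarded as an operator on `r ⊗ (a ⊗ b)`. -/
def assocTensor (X : Matrix (r × a) (r × a) ℂ) (Y : Matrix b b ℂ) :
    Matrix (r × a × b) (r × a × b) ℂ :=
  Matrix.of fun i j => X (i.1, i.2.1) (j.1, j.2.1) * Y i.2.2 j.2.2

theorem ampliation_assocTensor {E : Superop (a × b) (p × q)} {F : Superop a p} {T : Superop b q}
    (h : IsTensorMap E F T) (X : Matrix (r × a) (r × a) ℂ) (Y : Matrix b b ℂ) :
    ampliation r E (assocTensor X Y) = assocTensor (ampliation r F X) (T Y) := by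
  ext i j
  exact congrFun (congrFun (h (Matrix.of fun x y => X (i.1, x) (j.1, y)) Y) i.2) j.2

theorem IsCP.posSemidef_apply {m n : Type} [Fintype m] [Fintype n] {E : Superop m n}
    (hE : IsCP E) {X : Matrix m m ℂ} (hX : X.PosSemidef) : (E X).PosSemidef :=
  (hE Unit (X.submatrix Prod.snd Prod.snd) (hX.submatrix _)).submatrix fun x => ((), x)

/-- The separable operators on `r ⊗ a ⊗ b` for the cut `r a | b`: the closed cone generated by the
tensor products of positive semidefinite operators. -/
noncomputable def sepCone (r a b : Type) : AddSubmonoid (Matrix (r × a × b) (r × a × b) ℂ) :=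
  (AddSubmonoid.closure {Z | ∃ (X : Matrix (r × a) (r × a) ℂ) (Y : Matrix b b ℂ),
    X.PosSemidef ∧ Y.PosSemidef ∧ Z = assocTensor X Y}).topologicalClosure

theorem isClosed_sepCone : IsClosed (sepCone r a b : Set (Matrix (r × a × b) (r × a × b) ℂ)) :=
  AddSubmonoid.isClosed_topologicalClosure _

theorem assocTensor_mem_sepCone {X : Matrix (r × a) (r × a) ℂ} {Y : Matrix b b ℂ}
    (hX : X.PosSemidef) (hY : Y.PosSemidef) : assocTensor X Y ∈ sepCone r a b :=
  AddSubmonoid.le_topologicalClosure _ (AddSubmonoid.subset_closure ⟨X, Y, hX, hY, rfl⟩)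

/-- A closed additive submonoid pulled back along a linear map contains the separable operators as
soon as it contains the products. -/
theorem map_mem_of_mem_sepCone [Fintype r] [Fintype a] [Fintype b]
    {V : Type} [AddCommGroup V] [Module ℂ V] [TopologicalSpace V] [IsTopologicalAddGroup V]
    [ContinuousSMul ℂ V] (E : Matrix (r × a × b) (r × a × b) ℂ →ₗ[ℂ] V) (S : AddSubmonoid V)
    (hS : IsClosed (S : Set V))
    (h : ∀ (X : Matrix (r × a) (r × a) ℂ) (Y : Matrix b b ℂ),
      X.PosSemidef → Y.PosSemidef → E (assocTensor X Y) ∈ S)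
    {Z : Matrix (r × a × b) (r × a × b) ℂ} (hZ : Z ∈ sepCone r a b) : E Z ∈ S := by
  have hc : Continuous E := E.continuous_of_finiteDimensional
  have hle : sepCone r a b ≤ S.comap E.toAddMonoidHom := by
    refine AddSubmonoid.topologicalClosure_minimal _ ?_ (hS.preimage hc)
    rw [AddSubmonoid.closure_le]
    rintro _ ⟨X, Y, hX, hY, rfl⟩
    exact h X Y hX hY
  exact hle hZ

/-- Maps that preserve separability in the presence of an ancilla of the first party. -/
def PreservesSep (E : Superop (a × b) (p × q)) : Prop :=
  ∀ (r : Type) [Fintype r], ∀ Z ∈ sepCone r a b, ampliation r E Z ∈ sepCone r p q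

/-- The ancilla belongs to the first party, so `F` needs complete positivity, while positivity of
`T` suffices. Linearity and closedness of the cone reduce the claim to products. -/
theorem IsTensorMap.preservesSep [Fintype a] [Fintype b] [Fintype p] [Fintype q]
    {E : Superop (a × b) (p × q)} {F : Superop a p} {T : Superop b q}
    (h : IsTensorMap E F T) (hF : IsCP F) (hT : IsCP T) : PreservesSep E := by
  intro r _ Z hZ
  refine map_mem_of_mem_sepCone (ampliationLinear r E) _ isClosed_sepCone (fun X Y hX hY => ?_) hZ
  change ampliation r E _ ∈ _
  rw [ampliation_assocTensor h]
  exact assocTensor_mem_sepCone (hF r X hX) (hT.posSemidef_apply hY)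

theorem PreservesSep.comp {p' q' : Type} {G : Superop (p × q) (p' × q')}
    {E : Superop (a × b) (p × q)} (hG : PreservesSep G) (hE : PreservesSep E) :
    PreservesSep (G.comp E) :=
  fun r _ Z hZ => hG r _ (hE r Z hZ)

/-- This is where closedness of the cone matters: it covers countable sums over outcomes and the
limit over rounds. -/
theorem PreservesSep.of_tendsto {ι : Type} {l : Filter ι} [l.NeBot]
    {E : ι → Superop (a × b) (p × q)} {E' : Superop (a × b) (p × q)}
    (hE : ∀ i, PreservesSep (E i))
    (h : ∀ X, Filter.Tendsto (fun i => E i X) l (𝓝 (E' X))) : PreservesSep E' := by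
  intro r _ Z hZ
  refine isClosed_sepCone.mem_of_tendsto (f := fun i => ampliation r (E i) Z) (b := l) ?_
    (Filter.Eventually.of_forall fun i => hE i r Z hZ)
  refine tendsto_pi_nhds.2 fun x => tendsto_pi_nhds.2 fun y => ?_
  exact tendsto_pi_nhds.1 (tendsto_pi_nhds.1 (h _) x.2) y.2

theorem PreservesSep.sum {ι : Type} {E : ι → Superop (a × b) (p × q)}
    (hE : ∀ i, PreservesSep (E i)) (s : Finset ι) : PreservesSep (∑ i ∈ s, E i) := by
  intro r _ Z hZ
  have : ampliation r (∑ i ∈ s, E i) Z = ∑ i ∈ s, ampliation r (E i) Z := by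
    ext x y
    simp [ampliation, Matrix.sum_apply]
  rw [this]
  exact sum_mem fun i _ => hE i r Z hZ

theorem PreservesSep.of_hasSum {ι : Type} {E : ι → Superop (a × b) (p × q)}
    {E' : Superop (a × b) (p × q)} (hE : ∀ i, PreservesSep (E i))
    (h : ∀ X, HasSum (fun i => E i X) (E' X)) : PreservesSep E' := by
  refine .of_tendsto (l := Filter.atTop) (fun s : Finset ι => PreservesSep.sum hE s) fun X => ?_
  simpa [HasSum, LinearMap.sum_apply] using h X

theorem IsOneWayLocal.preservesSep [Fintype a] [Fintype b] [Fintype p] [Fintype q]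
    {ι : Type} {E : ι → Superop (a × b) (p × q)}
    (h : IsOneWayLocal E) (j : ι) : PreservesSep (E j) := by
  rcases h with ⟨F, T, hF, hT, h⟩ | ⟨T, F, hT, hF, h⟩
  · exact (h j).preservesSep (hF.1 j) (hT j).1
  · exact (h j).preservesSep (hT j).1 (hF.1 j)

theorem IsLOCCLinked.preservesSep [Fintype p] [Fintype q] {κ ι p' q' : Type}
    [Fintype p'] [Fintype q']
    {E' : κ → Superop (a × b) (p' × q')} {E : ι → Superop (a × b) (p × q)}
    (h : IsLOCCLinked E' E) (hE : ∀ j, PreservesSep (E j)) (k : κ) : PreservesSep (E' k) := by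
  obtain ⟨l, -, G, hG, f, hf⟩ := h
  have hc : ∀ s : (Σ j, l j), PreservesSep ((G s.1 s.2).comp (E s.1)) :=
    fun s => ((hG s.1).preservesSep s.2).comp (hE s.1)
  exact PreservesSep.of_hasSum
    (E := fun s : {s : (Σ j, l j) // f s = k} => (G s.1.1 s.1.2).comp (E s.1.1))
    (fun s => hc s.1) (hf k)

theorem IsLOCC.preservesSep [Fintype a] [Fintype b] [Fintype p] [Fintype q]
    {M : Superop (a × b) (p × q)} (h : IsLOCC M) : PreservesSep M := by
  obtain ⟨-, P, Q, _, _, ι, -, E, h0, hl, S, T, W, N, hW, hN, hM⟩ := h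
  have hE : ∀ n j, PreservesSep (E n j) := by
    intro n
    induction n with
    | zero => exact h0.preservesSep
    | succ n ih => exact (hl n).preservesSep ih
  refine .of_tendsto (fun n => ?_) hM
  exact .of_hasSum (E := fun j => (W n j).comp (E n j))
    (fun j => ((hW n j).2.2.preservesSep (hW n j).1.1 (hW n j).2.1.1).comp (hE n j)) (hN n)

end Separability

/-! ### Positive operators and overlaps with pure states -/

section Fidelity

open Matrix

variable {m n : Type} [Fintype m] [Fintype n]

theorem star_dotProduct_self_eq_sum (x : n → ℂ) :
    star x ⬝ᵥ x = ((∑ i, ‖x i‖ ^ 2 : ℝ) : ℂ) := by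
  simp [dotProduct, ← Complex.normSq_eq_conj_mul_self, Complex.normSq_eq_norm_sq]

/-- With X = BᴴB, this is Cauchy–Schwarz on each row of B. -/
theorem Matrix.PosSemidef.dotProduct_mulVec_le_trace_mul {X : Matrix n n ℂ} (hX : X.PosSemidef)
    (x : n → ℂ) : star x ⬝ᵥ (X *ᵥ x) ≤ X.trace * (star x ⬝ᵥ x) := by
  classical
  obtain ⟨B, rfl⟩ : ∃ B : Matrix n n ℂ, X = Bᴴ * B := by
    open scoped MatrixOrder in
    exact CStarAlgebra.nonneg_iff_eq_star_mul_self.mp hX.nonneg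
  have h1 : star x ⬝ᵥ ((Bᴴ * B) *ᵥ x) = ((∑ i, ‖(B *ᵥ x) i‖ ^ 2 : ℝ) : ℂ) := by
    rw [← star_dotProduct_self_eq_sum, ← mulVec_mulVec, dotProduct_mulVec, star_mulVec]
  have h2 : (Bᴴ * B).trace = ((∑ i, ∑ j, ‖B i j‖ ^ 2 : ℝ) : ℂ) := by
    rw [Finset.sum_comm]
    simp [trace, mul_apply, ← Complex.normSq_eq_conj_mul_self, Complex.normSq_eq_norm_sq]
  rw [h1, h2, star_dotProduct_self_eq_sum, ← Complex.ofReal_mul, Complex.real_le_real,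
    Finset.sum_mul]
  refine Finset.sum_le_sum fun i _ => ?_
  calc ‖(B *ᵥ x) i‖ ^ 2 ≤ (∑ j, ‖B i j‖ * ‖x j‖) ^ 2 := by
        gcongr
        exact (norm_sum_le _ _).trans (by simp)
    _ ≤ _ := Finset.sum_mul_sq_le_sq_mul_sq _ _ _

/-- Over `ℂ` a real-valued quadratic form already forces the matrix to be Hermitian. -/
theorem Matrix.posSemidef_of_forall_dotProduct_mulVec_nonneg {X : Matrix n n ℂ}
    (hX : ∀ x, 0 ≤ star x ⬝ᵥ (X *ᵥ x)) : X.PosSemidef := by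
  classical
  refine .of_dotProduct_mulVec_nonneg ?_ hX
  rw [← isSymmetric_toEuclideanLin_iff, LinearMap.isSymmetric_iff_inner_map_self_real]
  intro v
  have h := (IsSelfAdjoint.of_nonneg (hX v.ofLp)).star_eq
  rw [inner_conj_symm]
  have e : inner ℂ v (X.toEuclideanLin v) = star v.ofLp ⬝ᵥ (X *ᵥ v.ofLp) := by
    rw [EuclideanSpace.inner_eq_star_dotProduct, dotProduct_comm]
    rfl
  rw [← inner_conj_symm (X.toEuclideanLin v), e]
  exact h.symm

theorem pureState_posSemidef (v : n → ℂ) : (pureState v).PosSemidef :=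
  posSemidef_vecMulVec_self_star v

theorem trace_pureState (v : n → ℂ) : (pureState v).trace = star v ⬝ᵥ v := by
  simp [pureState, trace_vecMulVec, dotProduct_comm]

theorem dotProduct_pureState_mulVec (v x : n → ℂ) :
    star x ⬝ᵥ (pureState v *ᵥ x) = star (star v ⬝ᵥ x) * (star v ⬝ᵥ x) := by
  rw [pureState, vecMulVec_mulVec, dotProduct_smul, star_dotProduct x v]
  simp [mul_comm]

/-- Monotonicity of the fidelity under a positive trace-preserving map that sends a pure state to a
pure state. -/
theorem overlap_le_of_map_pureState {E : Superop m n}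
    (hpos : ∀ X : Matrix m m ℂ, X.PosSemidef → (E X).PosSemidef)
    (htr : ∀ X, (E X).trace = X.trace) {φ : m → ℂ} {f : n → ℂ}
    (hφ : star φ ⬝ᵥ φ = 1) (hf : star f ⬝ᵥ f = 1) (hE : E (pureState φ) = pureState f)
    (s : m → ℂ) :
    star (star φ ⬝ᵥ s) * (star φ ⬝ᵥ s) ≤ star f ⬝ᵥ (E (pureState s) *ᵥ f) := by
  classical
  -- Q is the adjoint of `E` applied to |f⟩⟨f|. Positivity of `E` gives 0 ≤ Q, and trace
  -- preservation gives Q ≤ 1.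
  let Q : Matrix m m ℂ := Matrix.of fun i j => star f ⬝ᵥ (E (single j i 1) *ᵥ f)
  have hQ : ∀ x, star x ⬝ᵥ (Q *ᵥ x) = star f ⬝ᵥ (E (pureState x) *ᵥ f) := by
    intro x
    have hx : pureState x = ∑ j, ∑ i, (x j * star (x i)) • single j i (1 : ℂ) := by
      conv_lhs => rw [matrix_eq_sum_single (pureState x)]
      simp [pureState, vecMulVec_apply]
    have hsum : star x ⬝ᵥ (Q *ᵥ x) = ∑ i, ∑ j, star (x i) * (Q i j * x j) := by
      simp [dotProduct, mulVec, Finset.mul_sum]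
    rw [hsum, hx]
    simp only [map_sum, map_smul, sum_mulVec, smul_mulVec, dotProduct_sum, dotProduct_smul]
    rw [Finset.sum_comm]
    refine Finset.sum_congr rfl fun j _ => Finset.sum_congr rfl fun i _ => ?_
    simp only [Q, of_apply, smul_eq_mul]
    ring
  have hQpos : Q.PosSemidef := posSemidef_of_forall_dotProduct_mulVec_nonneg fun x => by
    rw [hQ]
    exact (hpos _ (pureState_posSemidef x)).dotProduct_mulVec_nonneg f
  have hQle : (1 - Q).PosSemidef := posSemidef_of_forall_dotProduct_mulVec_nonneg fun x => by
    rw [sub_mulVec, one_mulVec, dotProduct_sub, hQ, sub_nonneg]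
    have := (hpos _ (pureState_posSemidef x)).dotProduct_mulVec_le_trace_mul f
    rwa [htr, trace_pureState, hf, mul_one] at this
  -- The form of 1 - Q ≥ 0 vanishes at φ, so φ lies in its kernel.
  have hQφ : Q *ᵥ φ = φ := by
    have h0 : star φ ⬝ᵥ ((1 - Q) *ᵥ φ) = 0 := by
      rw [sub_mulVec, one_mulVec, dotProduct_sub, hQ, hE, dotProduct_pureState_mulVec, hφ, hf]
      simp
    have := (open scoped MatrixOrder in (hQle.dotProduct_mulVec_zero_iff φ).1 h0)
    rw [sub_mulVec, one_mulVec, sub_eq_zero] at this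
    exact this.symm
  have hP : (pureState φ)ᴴ = pureState φ := (pureState_posSemidef φ).isHermitian
  have hQP : Q * pureState φ = pureState φ := by
    rw [pureState, mul_vecMulVec, hQφ]
  have hPQ : pureState φ * Q = pureState φ := by
    have := congrArg conjTranspose hQP
    rwa [conjTranspose_mul, hP, hQpos.isHermitian.eq] at this
  have hPP : pureState φ * pureState φ = pureState φ := by
    rw [pureState, vecMulVec_mul_vecMulVec, hφ]
    simp
  -- Since Q fixes φ, with P = |φ⟩⟨φ| one has Q - P = (1 - P)Q(1 - P).
  have hR : (Q - pureState φ).PosSemidef := by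
    have := hQpos.conjTranspose_mul_mul_same (1 - pureState φ)
    rw [conjTranspose_sub, conjTranspose_one, hP, sub_mul, sub_mul, mul_sub, mul_sub] at this
    simpa [hPQ, hQP, hPP] using this
  have := hR.dotProduct_mulVec_nonneg s
  rwa [sub_mulVec, dotProduct_sub, hQ, dotProduct_pureState_mulVec, sub_nonneg] at this

end Fidelity

/-! ### Overlap of separable operators with an entangled vector -/

section SchmidtBound

open Matrix

variable {r a b : Type} [Fintype r] [Fintype a] [Fintype b]

theorem assocTensor_posSemidef {X : Matrix (r × a) (r × a) ℂ} {Y : Matrix b b ℂ}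
    (hX : X.PosSemidef) (hY : Y.PosSemidef) : (assocTensor X Y).PosSemidef :=
  (hX.kronecker hY).submatrix fun i : r × a × b => ((i.1, i.2.1), i.2.2)

theorem trace_assocTensor (X : Matrix (r × a) (r × a) ℂ) (Y : Matrix b b ℂ) :
    (assocTensor X Y).trace = X.trace * Y.trace := by
  simp only [trace, assocTensor, diag_apply, of_apply, Fintype.sum_prod_type, ← Finset.sum_mul,
    ← Finset.mul_sum]

/-- A product operator overlaps a vector at most as much as the largest squared Schmidt coefficient
of that vector allows. -/
theorem dotProduct_assocTensor_mulVec_le {f : r × a × b → ℂ} {g : r × a → ℂ} {c : ℂ}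
    (hg : ∀ i j : r × a, ∑ k, star (f (i.1, i.2, k)) * f (j.1, j.2, k) =
      open scoped Classical in if i = j then g i else 0)
    (hgc : ∀ i, g i ≤ c)
    {X : Matrix (r × a) (r × a) ℂ} {Y : Matrix b b ℂ}
    (hX : X.PosSemidef) (hY : Y.PosSemidef) :
    star f ⬝ᵥ (assocTensor X Y *ᵥ f) ≤ c * (assocTensor X Y).trace := by
  classical
  -- Y ≤ (tr Y)·1 reduces the bound to Y = 1, where only the reduced state of f on r ⊗ a matters.
  have hY' : (Y.trace • (1 : Matrix b b ℂ) - Y).PosSemidef :=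
    posSemidef_of_forall_dotProduct_mulVec_nonneg fun x => by
      rw [sub_mulVec, smul_mulVec, one_mulVec, dotProduct_sub, dotProduct_smul, sub_nonneg]
      exact hY.dotProduct_mulVec_le_trace_mul x
  have hsplit : assocTensor X (Y.trace • (1 : Matrix b b ℂ) - Y) =
      Y.trace • assocTensor X 1 - assocTensor X Y := by
    ext i j
    simp only [assocTensor, of_apply, Matrix.sub_apply, Matrix.smul_apply, smul_eq_mul]
    ring
  have h1 := (assocTensor_posSemidef hX hY').dotProduct_mulVec_nonneg f
  rw [hsplit, sub_mulVec, dotProduct_sub, sub_nonneg, smul_mulVec, dotProduct_smul] at h1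
  -- By `hg` that reduced state is diagonal, so only the diagonal of X contributes.
  have h2 : star f ⬝ᵥ (assocTensor X 1 *ᵥ f) = ∑ i, X i i * g i := by
    have : star f ⬝ᵥ (assocTensor X 1 *ᵥ f) =
        ∑ i : r × a, ∑ j : r × a, X i j * ∑ k, star (f (i.1, i.2, k)) * f (j.1, j.2, k) := by
      simp only [dotProduct, mulVec, assocTensor, of_apply, Fintype.sum_prod_type, one_apply,
        mul_ite, ite_mul, mul_one, mul_zero, zero_mul, Finset.sum_ite_eq, Finset.mem_univ, if_true,
        Pi.star_apply, Finset.mul_sum]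
      refine Finset.sum_congr rfl fun i _ => Finset.sum_congr rfl fun i' _ => ?_
      rw [Finset.sum_comm]
      refine Finset.sum_congr rfl fun j _ => ?_
      rw [Finset.sum_comm]
      exact Finset.sum_congr rfl fun j' _ => Finset.sum_congr rfl fun k _ => by ring
    rw [this]
    simp only [hg]
    simp
  have h3 : ∑ i, X i i * g i ≤ X.trace * c := by
    rw [trace, Finset.sum_mul]
    exact Finset.sum_le_sum fun i _ => mul_le_mul_of_nonneg_left (hgc i) hX.diag_nonneg
  calc _ ≤ Y.trace • (star f ⬝ᵥ (assocTensor X 1 *ᵥ f)) := h1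
    _ ≤ Y.trace * (X.trace * c) := by
      rw [h2, smul_eq_mul]
      exact mul_le_mul_of_nonneg_left h3 hY.trace_nonneg
    _ = _ := by rw [trace_assocTensor]; ring

theorem dotProduct_mulVec_le_of_mem_sepCone {f : r × a × b → ℂ} {g : r × a → ℂ} {c : ℂ}
    (hg : ∀ i j : r × a, ∑ k, star (f (i.1, i.2, k)) * f (j.1, j.2, k) =
      open scoped Classical in if i = j then g i else 0)
    (hgc : ∀ i, g i ≤ c) {Z : Matrix (r × a × b) (r × a × b) ℂ} (hZ : Z ∈ sepCone r a b) :
    star f ⬝ᵥ (Z *ᵥ f) ≤ c * Z.trace := by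
  -- The bound is linear in Z: it says that this functional takes values in the closed cone of
  -- nonnegative numbers, which need only be tested on products.
  let ℓ : Matrix (r × a × b) (r × a × b) ℂ →ₗ[ℂ] ℂ :=
    { toFun := fun Z => c * Z.trace - star f ⬝ᵥ (Z *ᵥ f)
      map_add' := fun X Y => by
        rw [trace_add, add_mulVec, dotProduct_add]; ring
      map_smul' := fun t X => by
        rw [trace_smul, smul_mulVec, dotProduct_smul]
        simp only [smul_eq_mul, RingHom.id_apply]; ring }
  have : ℓ Z ∈ AddSubmonoid.nonneg ℂ :=
    map_mem_of_mem_sepCone ℓ _ isClosed_Ici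
      (fun X Y hX hY => sub_nonneg.2 (dotProduct_assocTensor_mulVec_le hg hgc hX hY)) hZ
  exact sub_nonneg.1 this

end SchmidtBound

/-! ### Norms and Schmidt coefficients of the merging states -/

section Merging

open Matrix

variable {R A B : Type} [Fintype R] [Fintype A] [Fintype B] {dA dB : ℕ}

theorem star_mergeInput_dotProduct (ψ ψ' : EuclideanSpace ℂ (R × A × B))
    (Φ Φ' : Fin dA × Fin dB → ℂ) :
    star (mergeInput ψ Φ) ⬝ᵥ mergeInput ψ' Φ' =
      (star ψ.ofLp ⬝ᵥ ψ'.ofLp) * (star Φ ⬝ᵥ Φ') := by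
  simp only [dotProduct, mergeInput, Fintype.sum_prod_type, Finset.sum_mul_sum, Pi.star_apply,
    star_mul']
  simp only [Finset.sum_mul]
  refine Finset.sum_congr rfl fun i _ => ?_
  rw [Finset.sum_comm]
  refine Finset.sum_congr rfl fun x _ => Finset.sum_congr rfl fun j _ => ?_
  rw [Finset.sum_comm]
  exact Finset.sum_congr rfl fun y _ => Finset.sum_congr rfl fun k _ => by ring

theorem sum_star_maxEntangled_mul {K : ℕ} (hK : K ≤ dB) (x x' : Fin dA) :
    ∑ y : Fin dB, star (maxEntangled K dA dB (x, y)) * maxEntangled K dA dB (x', y) =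
      if x = x' then (if x.val < K then (K : ℂ)⁻¹ else 0) else 0 := by
  split_ifs with h h'
  · subst h
    rw [Finset.sum_eq_single (⟨x.val, h'.trans_le hK⟩ : Fin dB)]
    · simp only [maxEntangled, h', and_self, if_true, Complex.star_def, Complex.conj_ofReal]
      rw [← Complex.ofReal_mul, ← mul_inv, Real.mul_self_sqrt (Nat.cast_nonneg K)]
      simp
    · intro y _ hy
      have : x.val ≠ y.val := fun h => hy (Fin.ext h.symm)
      simp [maxEntangled, this]
    · simp
  · subst h
    simp [maxEntangled, h']
  · refine Finset.sum_eq_zero fun y _ => ?_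
    by_cases h1 : x.val = y.val
    · have : x'.val ≠ y.val := fun h2 => h (Fin.ext (h1.trans h2.symm))
      simp [maxEntangled, this]
    · simp [maxEntangled, h1]

theorem sum_maxEntangled_weights {K : ℕ} (hK : 1 ≤ K) (hKA : K ≤ dA) :
    ∑ x : Fin dA, (if x.val < K then (K : ℂ)⁻¹ else 0) = 1 := by
  rw [Fin.sum_univ_eq_sum_range (fun x => if x < K then (K : ℂ)⁻¹ else 0) dA,
    ← Finset.sum_filter]
  have : (Finset.range dA).filter (· < K) = Finset.range K := by
    ext x
    simp only [Finset.mem_filter, Finset.mem_range]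
    omega
  rw [this, Finset.sum_const, Finset.card_range, nsmul_eq_mul, mul_inv_cancel₀]
  exact_mod_cast (by omega : K ≠ 0)

theorem star_maxEntangled_dotProduct_self {K : ℕ} (hK : 1 ≤ K) (hKA : K ≤ dA) (hKB : K ≤ dB) :
    star (maxEntangled K dA dB) ⬝ᵥ maxEntangled K dA dB = 1 := by
  rw [dotProduct, Fintype.sum_prod_type, ← sum_maxEntangled_weights hK hKA]
  refine Finset.sum_congr rfl fun x _ => ?_
  simpa using sum_star_maxEntangled_mul hKB x x

omit [Fintype R] in
theorem reducedR_apply (ψ : EuclideanSpace ℂ (R × A × B)) (i j : R) :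
    reducedR ψ i j = ∑ k, ψ (i, k) * star (ψ (j, k)) := rfl

-- The Gram matrix factors through ψ^R = 1/D and the half of Φ_L held by `A`, since `B'` and `B`
-- both lie on the side traced out. Its nonzero entries are all 1/(DL).
omit [Fintype R] in
theorem sum_star_mergeOutput_mul [DecidableEq R] {ψ : EuclideanSpace ℂ (R × A × B)} {D : ℕ}
    (hR : reducedR ψ = (D : ℂ)⁻¹ • (1 : Matrix R R ℂ)) {L : ℕ} (hL : L ≤ dB)
    (i j : R × Fin dA) :
    ∑ k, star (mergeOutput ψ (maxEntangled L dA dB) (i.1, i.2, k)) *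
        mergeOutput ψ (maxEntangled L dA dB) (j.1, j.2, k) =
      if i = j then (D : ℂ)⁻¹ * (if i.2.val < L then (L : ℂ)⁻¹ else 0) else 0 := by
  have h1 : ∑ k, star (mergeOutput ψ (maxEntangled L dA dB) (i.1, i.2, k)) *
        mergeOutput ψ (maxEntangled L dA dB) (j.1, j.2, k) =
      reducedR ψ j.1 i.1 * ∑ y : Fin dB,
        star (maxEntangled L dA dB (i.2, y)) * maxEntangled L dA dB (j.2, y) := by
    rw [reducedR_apply, Finset.sum_mul_sum, Fintype.sum_prod_type]
    refine Finset.sum_congr rfl fun k _ => Finset.sum_congr rfl fun y _ => ?_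
    simp only [mergeOutput, star_mul']
    ring
  rw [h1, sum_star_maxEntangled_mul hL, hR]
  simp only [Matrix.smul_apply, one_apply, smul_eq_mul, Prod.ext_iff, @eq_comm R j.1 i.1]
  split_ifs <;> simp_all

theorem star_dotProduct_self_of_norm_eq_one {n : Type} [Fintype n] {v : EuclideanSpace ℂ n}
    (hv : ‖v‖ = 1) : star v.ofLp ⬝ᵥ v.ofLp = 1 := by
  rw [star_dotProduct_self_eq_sum, ← EuclideanSpace.norm_sq_eq, hv]
  simp

theorem trace_reducedR (ψ : EuclideanSpace ℂ (R × A × B)) :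
    (reducedR ψ).trace = star ψ.ofLp ⬝ᵥ ψ.ofLp := by
  simp only [trace, diag_apply, reducedR_apply, dotProduct, Fintype.sum_prod_type, Pi.star_apply,
    mul_comm]

theorem star_mergeOutput_dotProduct_self [DecidableEq R] {ψ : EuclideanSpace ℂ (R × A × B)}
    (hψ : ‖ψ‖ = 1) {D : ℕ} (hR : reducedR ψ = (D : ℂ)⁻¹ • (1 : Matrix R R ℂ)) {L : ℕ}
    (hL : 1 ≤ L) (hLA : L ≤ dA) (hLB : L ≤ dB) :
    star (mergeOutput ψ (maxEntangled L dA dB)) ⬝ᵥ mergeOutput ψ (maxEntangled L dA dB) = 1 := by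
  have ht := trace_reducedR ψ
  rw [star_dotProduct_self_of_norm_eq_one hψ, hR, trace_smul, trace_one, smul_eq_mul] at ht
  rw [dotProduct, Fintype.sum_prod_type]
  have h : ∀ i : R, ∑ y : Fin dA × ((A × B) × Fin dB),
      star (mergeOutput ψ (maxEntangled L dA dB)) (i, y) *
        mergeOutput ψ (maxEntangled L dA dB) (i, y) = (D : ℂ)⁻¹ := by
    intro i
    rw [Fintype.sum_prod_type, ← mul_one (D : ℂ)⁻¹, ← sum_maxEntangled_weights hL hLA,
      Finset.mul_sum]
    refine Finset.sum_congr rfl fun x _ => ?_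
    simpa using sum_star_mergeOutput_mul hR hLB (i, x) (i, x)
  rw [Finset.sum_congr rfl fun i _ => h i, Finset.sum_const, nsmul_eq_mul, Finset.card_univ,
    mul_comm]
  exact ht

end Merging

/-! ### The product test vector and the resource bound -/

section Main

open Matrix

variable {R A B : Type} [Fintype R] [Fintype A] [Fintype B]

theorem trace_ampliation {m n : Type} [Fintype m] [Fintype n] {E : Superop m n}
    (hE : ∀ X, (E X).trace = X.trace) (X : Matrix (R × m) (R × m) ℂ) :
    (ampliation R E X).trace = X.trace := by
  have h : ∀ i : R, ∑ x, ampliation R E X (i, x) (i, x) = ∑ x, X (i, x) (i, x) := fun i =>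
    hE (Matrix.of fun x y => X (i, x) (i, y))
  simp only [trace, diag_apply, Fintype.sum_prod_type, h]

/-- The entrywise conjugate of `ψ`, regarded as a matrix from `B` to `R ⊗ A`. -/
def conjMatrix (ψ : EuclideanSpace ℂ (R × A × B)) : Matrix (R × A) B ℂ :=
  Matrix.of fun i k => star (ψ (i.1, i.2, k))

omit [Fintype B] in
theorem reducedB_eq (ψ : EuclideanSpace ℂ (R × A × B)) :
    reducedB ψ = (conjMatrix ψ)ᴴ * conjMatrix ψ := by
  ext i j
  rw [mul_apply, Fintype.sum_prod_type, Finset.sum_comm]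
  simp [reducedB, traceLeft, pureState, vecMulVec_apply, conjMatrix]

/-- The vector of `R ⊗ A` that pairs `ψ` with the vector `v` of `B`. -/
def partialPairing (ψ : EuclideanSpace ℂ (R × A × B)) (v : B → ℂ) : R × A → ℂ :=
  conjMatrix ψ *ᵥ v

theorem star_dotProduct_reducedB_mulVec (ψ : EuclideanSpace ℂ (R × A × B)) (v : B → ℂ) :
    star v ⬝ᵥ (reducedB ψ *ᵥ v) = star (partialPairing ψ v) ⬝ᵥ partialPairing ψ v := by
  rw [reducedB_eq, ← mulVec_mulVec, dotProduct_mulVec, partialPairing, star_mulVec]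

theorem trace_reducedB (ψ : EuclideanSpace ℂ (R × A × B)) :
    (reducedB ψ).trace = star ψ.ofLp ⬝ᵥ ψ.ofLp := by
  rw [reducedB_eq, trace_mul_comm]
  simp [trace, mul_apply, dotProduct, Fintype.sum_prod_type, conjMatrix]

/-- The eigenvalues of ψ^B sum to its trace 1, so they cannot all be nonpositive. -/
theorem exists_pos_eigenvalue [DecidableEq B] {ψ : EuclideanSpace ℂ (R × A × B)} (hψ : ‖ψ‖ = 1) :
    ∃ x : ℝ, 0 < x ∧ Module.End.HasEigenvalue (toLin' (reducedB ψ)) (x : ℂ) := by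
  have hpos : (reducedB ψ).PosSemidef := by
    rw [reducedB_eq]
    exact posSemidef_conjTranspose_mul_self _
  have htr : (reducedB ψ).trace = 1 := by
    rw [trace_reducedB, star_dotProduct_self_of_norm_eq_one hψ]
  by_contra! h
  have hle : ∀ i, hpos.isHermitian.eigenvalues i ≤ 0 := by
    intro i
    by_contra! hi
    refine h _ hi (Module.End.hasEigenvalue_of_hasEigenvector
      (x := (hpos.isHermitian.eigenvectorBasis i).ofLp) ⟨?_, ?_⟩)
    · rw [Module.End.mem_eigenspace_iff, toLin'_apply]
      simpa using hpos.isHermitian.mulVec_eigenvectorBasis i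
    · intro h0
      exact hpos.isHermitian.eigenvectorBasis.orthonormal.ne_zero i (by ext j; exact congrFun h0 j)
  have := hpos.isHermitian.trace_eq_sum_eigenvalues
  have h1 : (1 : ℝ) = ∑ i, hpos.isHermitian.eigenvalues i := by
    rw [htr] at this
    simpa using congrArg Complex.re this
  linarith [Finset.sum_nonpos fun i (_ : i ∈ Finset.univ) => hle i]

/-- The product vector `w̄ ⊗ v` of `R ⊗ A ⊗ B`. -/
noncomputable def productVector (w : R × A → ℂ) (v : B → ℂ) : EuclideanSpace ℂ (R × A × B) :=
  WithLp.toLp 2 fun i => star (w (i.1, i.2.1)) * v i.2.2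

theorem star_dotProduct_productVector (ψ : EuclideanSpace ℂ (R × A × B)) (v : B → ℂ) :
    star ψ.ofLp ⬝ᵥ (productVector (partialPairing ψ v) v).ofLp =
      star (partialPairing ψ v) ⬝ᵥ partialPairing ψ v := by
  simp only [dotProduct, productVector, Fintype.sum_prod_type, Pi.star_apply]
  refine Finset.sum_congr rfl fun i _ => Finset.sum_congr rfl fun j _ => ?_
  change _ = star (partialPairing ψ v (i, j)) * ∑ k, star (ψ (i, j, k)) * v k
  rw [Finset.mul_sum]
  exact Finset.sum_congr rfl fun k _ => by ring

theorem star_productVector_dotProduct_self (w : R × A → ℂ) (v : B → ℂ) :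
    star (productVector w v).ofLp ⬝ᵥ (productVector w v).ofLp =
      (star w ⬝ᵥ w) * (star v ⬝ᵥ v) := by
  simp only [dotProduct, productVector, Fintype.sum_prod_type, Pi.star_apply, Finset.sum_mul,
    star_mul', star_star]
  refine Finset.sum_congr rfl fun i _ => Finset.sum_congr rfl fun j _ => ?_
  rw [Finset.mul_sum]
  exact Finset.sum_congr rfl fun k _ => by ring

omit [Fintype R] [Fintype A] [Fintype B] in
theorem pureState_mergeInput_productVector {dA dB : ℕ} (w : R × A → ℂ) (v : B → ℂ)
    (x : Fin dA → ℂ) (y : Fin dB → ℂ) :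
    pureState (mergeInput (productVector w v) fun i => x i.1 * y i.2) =
      assocTensor (pureState fun i : R × A × Fin dA => star (w (i.1, i.2.1)) * x i.2.2)
        (pureState fun i : B × Fin dB => v i.1 * y i.2) := by
  ext i j
  simp only [pureState, vecMulVec_apply, mergeInput, productVector, assocTensor, of_apply,
    Pi.star_apply, star_mul']
  ring

theorem IsExactMerging.eigenvalue_mul_le [DecidableEq R] [DecidableEq B]
    {ψ : EuclideanSpace ℂ (R × A × B)} (hψ : ‖ψ‖ = 1) {D : ℕ} (hD : 0 < D)
    (hR : reducedR ψ = (D : ℂ)⁻¹ • (1 : Matrix R R ℂ)) {lam : ℝ} (hlam0 : 0 < lam)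
    (hlam : Module.End.HasEigenvalue (toLin' (reducedB ψ)) (lam : ℂ)) {K L dA dB : ℕ}
    {M : Superop ((A × Fin dA) × (B × Fin dB)) (Fin dA × ((A × B) × Fin dB))}
    (hM : IsExactMerging ψ K L M) : lam * D * L ≤ K := by
  obtain ⟨hK, hL, ⟨hKA, hKB⟩, ⟨hLA, hLB⟩, hlocc, hmerge⟩ := hM
  obtain ⟨v, hv⟩ := hlam.exists_hasEigenvector
  have hv1 : reducedB ψ *ᵥ v = (lam : ℂ) • v := by
    simpa using hv.apply_eq_smul
  set w := partialPairing ψ v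
  -- The eigenvector is not normalized; its squared norm V cancels at the end.
  set V : ℝ := ∑ i, ‖v i‖ ^ 2 with hV
  have hVv : star v ⬝ᵥ v = (V : ℂ) := star_dotProduct_self_eq_sum v
  have hVpos : 0 < V := by
    refine (Finset.sum_nonneg fun i _ => sq_nonneg _).lt_of_ne' fun h0 => hv.2 ?_
    rw [← dotProduct_star_self_eq_zero, hVv, hV, h0]
    simp
  have hw : star w ⬝ᵥ w = ((lam * V : ℝ) : ℂ) := by
    rw [← star_dotProduct_reducedB_mulVec, hv1, dotProduct_smul, hVv]
    simp
  -- The resource registers start in |0⟩ ⊗ |0⟩, whose overlap with Φ_K is 1/√K.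
  let x₀ : Fin dA := ⟨0, by omega⟩
  let y₀ : Fin dB := ⟨0, by omega⟩
  let e : Fin dA × Fin dB → ℂ := fun i =>
    (Pi.single x₀ 1 : Fin dA → ℂ) i.1 * (Pi.single y₀ 1 : Fin dB → ℂ) i.2
  have he : e = Pi.single (x₀, y₀) 1 := by
    ext i
    simp only [e, Pi.single_apply, Prod.ext_iff]
    split_ifs <;> simp_all
  have hΦe : star (maxEntangled K dA dB) ⬝ᵥ e = ((Real.sqrt K)⁻¹ : ℝ) := by
    have : 0 < K := hK
    simp [he, maxEntangled, x₀, y₀, this]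
  have hee : star e ⬝ᵥ e = 1 := by simp [he]
  set s := mergeInput (productVector w v) e with hs
  have hφs : star (mergeInput ψ (maxEntangled K dA dB)) ⬝ᵥ s =
      ((lam * V * (Real.sqrt K)⁻¹ : ℝ) : ℂ) := by
    rw [hs, star_mergeInput_dotProduct, hΦe, star_dotProduct_productVector, hw]
    push_cast
    rfl
  have htr : (pureState s).trace = ((lam * V * V : ℝ) : ℂ) := by
    rw [trace_pureState, hs, star_mergeInput_dotProduct, hee, star_productVector_dotProduct_self,
      hw, hVv]
    push_cast
    ring
  have hφ : star (mergeInput ψ (maxEntangled K dA dB)) ⬝ᵥ mergeInput ψ (maxEntangled K dA dB) =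
      1 := by
    rw [star_mergeInput_dotProduct, star_dotProduct_self_of_norm_eq_one hψ,
      star_maxEntangled_dotProduct_self hK hKA hKB, one_mul]
  have hlower := overlap_le_of_map_pureState (E := ampliationLinear R M) (hlocc.1.1 R)
    (trace_ampliation hlocc.1.2) hφ (star_mergeOutput_dotProduct_self hψ hR hL hLA hLB) hmerge s
  have hsep : ampliation R M (pureState s) ∈ sepCone R (Fin dA) ((A × B) × Fin dB) := by
    refine hlocc.preservesSep R _ ?_
    rw [hs, pureState_mergeInput_productVector]
    exact assocTensor_mem_sepCone (pureState_posSemidef _) (pureState_posSemidef _)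
  have hupper := dotProduct_mulVec_le_of_mem_sepCone
    (f := mergeOutput ψ (maxEntangled L dA dB))
    (g := fun i => (D : ℂ)⁻¹ * (if i.2.val < L then (L : ℂ)⁻¹ else 0))
    (c := (((D : ℝ)⁻¹ * (L : ℝ)⁻¹ : ℝ) : ℂ))
    (fun i j => by convert sum_star_mergeOutput_mul hR hLB i j)
    (fun i => by
      split_ifs
      · push_cast; rfl
      · rw [mul_zero]
        exact_mod_cast (by positivity : (0 : ℝ) ≤ (D : ℝ)⁻¹ * (L : ℝ)⁻¹)) hsep
  rw [trace_ampliation hlocc.1.2, htr] at hupper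
  have hineq := hlower.trans hupper
  rw [hφs, Complex.star_def, Complex.conj_ofReal, ← Complex.ofReal_mul, ← Complex.ofReal_mul,
    Complex.real_le_real] at hineq
  have hK0 : (0 : ℝ) < K := by exact_mod_cast hK
  have hL0 : (0 : ℝ) < L := by exact_mod_cast hL
  have hD0 : (0 : ℝ) < D := by exact_mod_cast hD
  have hsq : (Real.sqrt K)⁻¹ * (Real.sqrt K)⁻¹ = (K : ℝ)⁻¹ := by
    rw [← mul_inv, Real.mul_self_sqrt hK0.le]
  -- The squared overlap (λV)²/K is at most tr|s⟩⟨s| = λV² times 1/(DL); the common positive factor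
  -- λV² is then cancelled.
  have h1 : (lam * V * V) * (lam * (K : ℝ)⁻¹) ≤ (lam * V * V) * ((D : ℝ)⁻¹ * (L : ℝ)⁻¹) := by
    rw [← hsq]
    linarith
  have h2 := le_of_mul_le_mul_left h1 (by positivity)
  rw [← mul_inv, ← div_eq_mul_inv, div_le_iff₀ hK0, inv_mul_eq_div, le_div_iff₀ (by positivity)]
    at h2
  linarith

end Main

theorem corollary1 {R A B : Type} [Fintype R] [Fintype A] [Fintype B]
    [DecidableEq R] [DecidableEq B]
    (ψ : EuclideanSpace ℂ (R × A × B)) (hψ : ‖ψ‖ = 1)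
    (D : ℕ) (hR : reducedR ψ = (D : ℂ)⁻¹ • (1 : Matrix R R ℂ))
    (lam : ℝ)
    (hlam : IsGreatest
      {x : ℝ | Module.End.HasEigenvalue (Matrix.toLin' (reducedB ψ)) (x : ℂ)} lam) :
    (∀ (K L dA dB : ℕ)
      (M : Superop ((A × Fin dA) × (B × Fin dB)) (Fin dA × ((A × B) × Fin dB))),
      IsExactMerging ψ K L M →
        Real.logb 2 K - Real.logb 2 L ≥ Real.logb 2 (lam * D)) ∧
    (∀ (K dA dB : ℕ)
      (M : Superop ((A × Fin dA) × (B × Fin dB)) (Fin dA × ((A × B) × Fin dB))),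
      IsExactMerging ψ K 1 M →
        Real.logb 2 K ≥ Real.logb 2 (⌈lam * D⌉ : ℝ)) := by
  -- For D = 0 the convention 0⁻¹ = 0 would make ψ^R vanish, contradicting trace 1.
  have hD : 0 < D := by
    rcases Nat.eq_zero_or_pos D with rfl | h
    · have := trace_reducedR ψ
      rw [star_dotProduct_self_of_norm_eq_one hψ, hR] at this
      simp at this
    · exact h
  have hlam0 : 0 < lam := by
    obtain ⟨x, hx, hxe⟩ := exists_pos_eigenvalue hψ
    exact hx.trans_le (hlam.2 hxe)
  have hpos : 0 < lam * D := mul_pos hlam0 (by exact_mod_cast hD)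
  refine ⟨fun K L dA dB M hM => ?_, fun K dA dB M hM => ?_⟩
  · have h := hM.eigenvalue_mul_le hψ hD hR hlam0 hlam.1
    have hK : (0 : ℝ) < K := by exact_mod_cast hM.one_le_K
    have hL : (0 : ℝ) < L := by exact_mod_cast hM.one_le_L
    rw [ge_iff_le, ← Real.logb_div hK.ne' hL.ne']
    exact Real.logb_le_logb_of_le one_lt_two hpos ((le_div_iff₀ hL).2 h)
  · have h := hM.eigenvalue_mul_le hψ hD hR hlam0 hlam.1
    rw [Nat.cast_one, mul_one] at h
    refine Real.logb_le_logb_of_le one_lt_two ?_ ?_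
    · exact_mod_cast Int.ceil_pos.2 hpos
    -- With L = 1 the bound reads λD ≤ K, and K is an integer, so the ceiling obeys it too.
    · exact_mod_cast (Int.ceil_le.2 (by exact_mod_cast h) : ⌈lam * D⌉ ≤ (K : ℤ))
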